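/- Let $k\ge 3$ be a fixed integer. For a positive integer $n$ that is a multiple of $k$, let $\mathcal H_k=\mathcal H_k(n)$ be the set of all $k\times k$ matrices $\ell=(\ell_{ij})$ with nonnegative integer entries for which each row sum and each column sum equals $n/k$, and for real $c$ put $$A_n(c) := \frac{n^{k-1}}{k^{2n}}\left(1-\frac1k\right)^{-2nc}\sum_{\ell\in\mathcal H_k}\frac{n!}{\prod_{i,j}\ell_{ij}!}\left(1-\frac2k+\sum_{i,j}\left(\frac{\ell_{ij}}{n}\right)^2\right)^{nc}.$$ If $c$ is a fixed real number with $c<(k-1)\log(k-1)$, then $A_n(c)=O(1)$ as $n\to\infty$ through the multiples of $k$; that is, there is a constant $C$, depending only on $k$ and $c$, such that $A_n(c)\le C$ for all sufficiently large multiples $n$ of $k$. -/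

import Mathlib

open Filter Asymptotics

namespace AchlioptasNaor

/-- The finite set of all `k × k` matrices with nonnegative integer entries for which each row sum
and each column sum equals `n / k` (written as `k * sum = n`, so that no division occurs).
The bound `n` on the entries, which makes the set a `Finset`, is implied by the row sums, see
`mem_tables`. -/
def tables (k n : ℕ) : Finset (Fin k → Fin k → ℕ) :=
  (Fintype.piFinset fun _ : Fin k => Fintype.piFinset fun _ : Fin k => Finset.range (n + 1)).filter
    fun ℓ => (∀ i, k * ∑ j, ℓ i j = n) ∧ ∀ j, k * ∑ i, ℓ i j = n

theorem mem_tables {k n : ℕ} {ℓ : Fin k → Fin k → ℕ} :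
    ℓ ∈ tables k n ↔ (∀ i, k * ∑ j, ℓ i j = n) ∧ ∀ j, k * ∑ i, ℓ i j = n := by
  unfold tables
  rw [Finset.mem_filter]
  refine ⟨fun h => h.2, fun h => ⟨?_, h⟩⟩
  refine Fintype.mem_piFinset.2 fun i => Fintype.mem_piFinset.2 fun j => ?_
  rw [Finset.mem_range, Nat.lt_succ_iff]
  have hk : 0 < k := i.pos
  calc ℓ i j ≤ ∑ j', ℓ i j' := Finset.single_le_sum (fun _ _ => Nat.zero_le _) (Finset.mem_univ j)
    _ ≤ k * ∑ j', ℓ i j' := Nat.le_mul_of_pos_left _ hk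
    _ = n := h.1 i

/-- The ratio
`A_n(c) = n^(k-1) / k^(2n) * (1 - 1/k)^(-2nc)
  * ∑ ℓ, n! / (∏ i j, ℓ i j !) * (1 - 2/k + ∑ i j, (ℓ i j / n)^2)^(n c)`,
the sum running over `tables k n`; the powers with exponents `-2nc` and `nc` are real powers. -/
noncomputable def A (k : ℕ) (c : ℝ) (n : ℕ) : ℝ :=
  (n : ℝ) ^ (k - 1) / (k : ℝ) ^ (2 * n) * (1 - 1 / (k : ℝ)) ^ (-2 * (n : ℝ) * c) *
    ∑ ℓ ∈ tables k n,
      (n.factorial : ℝ) / (∏ i, ∏ j, ((ℓ i j).factorial : ℝ)) *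
        (1 - 2 / (k : ℝ) + ∑ i, ∑ j, ((ℓ i j : ℝ) / (n : ℝ)) ^ 2) ^ ((n : ℝ) * c)

end AchlioptasNaor

/-!
By Stirling's formula the multinomial coefficient of a table `ℓ` is at most
`e * √n * ∏ (ℓ i j + 1)^(-1/2) * exp (n * H (ℓ / n))`. The entropy `H (ℓ / n)` falls short of its
maximum `2 * log k` by a multiple of the squared distance `D` from `ℓ / n` to the uniform table.
This quadratic deficit is proved row by row with its best constant: all entries of a probability
vector but the largest are compared with their mean by a quadratic refinement of the convexity of
`x * log x`, which leaves a one-variable inequality for the binary entropy. The collision factor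
gains at most `exp (n * c * D / (1 - 1/k)^2)`, so for `c` below the threshold every term is at most
a product of entry weights with Gaussian decay on the scale `√n` around the mean. A table is
determined by a `(k - 1) × (k - 1)` block; the weights of the block sum to `O(1)` each,
and the remaining `2k - 1` weights are `O(n^(-1/2))`, which cancels `n^(k - 1) * √n`.
-/

namespace AchlioptasNaor

open Real InformationTheory

section LogInequalities

theorem two_mul_sub_one_le_add_one_mul_log {x : ℝ} (hx : 1 ≤ x) :
    2 * (x - 1) ≤ (x + 1) * log x := by
  have h := le_log_one_add_of_nonneg (sub_nonneg.2 hx)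
  rw [add_sub_cancel, div_le_iff₀ (by linarith)] at h
  linarith

theorem two_mul_mul_log_le_sq_sub_one {x : ℝ} (hx : 1 ≤ x) : 2 * x * log x ≤ x ^ 2 - 1 := by
  have hx0 : 0 < x := by linarith
  have h := self_le_sinh_iff.2 (log_nonneg hx)
  rw [sinh_log hx0] at h
  calc 2 * x * log x ≤ 2 * x * ((x - x⁻¹) / 2) := by gcongr
    _ = x ^ 2 - 1 := by field_simp

theorem two_mul_mul_sub_one_mul_log_le {a b : ℝ} (ha : 1 ≤ a) (hb : 1 ≤ b) :
    2 * a * (b - 1) * log a ≤ (a - 1) * (a * b + 1) * log b := by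
  have hab : (a + 1) * (b + 1) ≤ 2 * (a * b + 1) := by
    nlinarith [mul_nonneg (sub_nonneg.2 ha) (sub_nonneg.2 hb)]
  have ha' : 0 ≤ a - 1 := sub_nonneg.2 ha
  have hb' : 0 ≤ b - 1 := sub_nonneg.2 hb
  refine le_of_mul_le_mul_right ?_ (show 0 < b + 1 by linarith)
  calc 2 * a * (b - 1) * log a * (b + 1)
      = (b - 1) * (b + 1) * (2 * a * log a) := by ring
    _ ≤ (b - 1) * (b + 1) * (a ^ 2 - 1) :=
        mul_le_mul_of_nonneg_left (two_mul_mul_log_le_sq_sub_one ha)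
          (mul_nonneg hb' (by positivity))
    _ = (a - 1) * (b - 1) * ((a + 1) * (b + 1)) := by ring
    _ ≤ (a - 1) * (b - 1) * (2 * (a * b + 1)) := by gcongr
    _ = (a - 1) * (a * b + 1) * (2 * (b - 1)) := by ring
    _ ≤ (a - 1) * (a * b + 1) * ((b + 1) * log b) :=
        mul_le_mul_of_nonneg_left (two_mul_sub_one_le_add_one_mul_log hb)
          (mul_nonneg ha' (by positivity))
    _ = (a - 1) * (a * b + 1) * log b * (b + 1) := by ring

theorem sub_one_mul_add_one_mul_log_le {r t : ℝ} (hr : 1 ≤ r) (hrt : r ≤ t) :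
    (t - 1) * (r + 1) * log r ≤ (r - 1) * (t + 1) * log t := by
  have hr0 : 0 < r := by linarith
  have h := two_mul_mul_sub_one_mul_log_le hr ((one_le_div hr0).2 hrt)
  rw [log_div (by linarith) hr0.ne', mul_div_cancel₀ _ hr0.ne',
    show 2 * r * (t / r - 1) = 2 * (t - r) by field_simp] at h
  linarith

theorem two_mul_mul_sub_one_mul_log_le_of_le {u s : ℝ} (hu : 1 ≤ u) (hus : u ≤ s) :
    2 * s * (u - 1) * log s ≤ (s - 1) * (u + s) * log u := by
  have hu0 : 0 < u := by linarith
  have h := mul_le_mul_of_nonneg_left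
    (two_mul_mul_sub_one_mul_log_le ((one_le_div hu0).2 hus) hu) hu0.le
  rw [log_div (by linarith) hu0.ne', div_mul_cancel₀ _ hu0.ne',
    show u * (2 * (s / u) * (u - 1) * (log s - log u)) = 2 * s * (u - 1) * (log s - log u) by
      field_simp,
    show u * ((s / u - 1) * (s + 1) * log u) = (s - u) * (s + 1) * log u by field_simp] at h
  linarith

theorem half_sq_le_klFun {u : ℝ} (hu0 : 0 ≤ u) (hu1 : u ≤ 1) : (u - 1) ^ 2 / 2 ≤ klFun u := by
  rw [klFun_apply]
  rcases hu0.eq_or_lt with rfl | hu0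
  · norm_num
  · have h := mul_le_mul_of_nonneg_left (two_mul_mul_log_le_sq_sub_one (one_le_inv₀ hu0 |>.2 hu1))
      (sq_nonneg u)
    rw [log_inv, show u ^ 2 * (2 * u⁻¹ * -log u) = -(2 * (u * log u)) by field_simp,
      show u ^ 2 * (u⁻¹ ^ 2 - 1) = 1 - u ^ 2 by field_simp] at h
    linarith

theorem sub_one_mul_log_le_two_mul_klFun {u : ℝ} (hu : 1 ≤ u) :
    (u - 1) * log u ≤ 2 * klFun u := by
  rw [klFun_apply]
  linarith [two_mul_sub_one_le_add_one_mul_log hu]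

end LogInequalities

/-- The best constant `β` for which the entropy of a probability vector `p` with `s + 1` entries
falls short of its maximum `log (s + 1)` by at least `β * (∑ i, p i ^ 2 - 1 / (s + 1))`; equality
holds when one entry of `p` is `s / (s + 1)` and the others are equal. -/
noncomputable def entropyConst (s : ℝ) : ℝ := s * log s / (s - 1)

section EntropyConst

variable {s : ℝ}

theorem entropyConst_le (hs : 1 < s) : entropyConst s ≤ (s + 1) / 2 := by
  rw [entropyConst, div_le_iff₀ (by linarith)]
  linarith [two_mul_mul_log_le_sq_sub_one hs.le]

theorem entropyConst_mul_sq_le {u : ℝ} (hs : 1 < s) (hu : 1 ≤ u) (hus : u ≤ s) :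
    entropyConst s * (u - 1) ^ 2 ≤ (u + s) * klFun u := by
  have hs1 : 0 < s - 1 := sub_pos.2 hs
  have hu1 : 0 ≤ u - 1 := sub_nonneg.2 hu
  calc entropyConst s * (u - 1) ^ 2
      = 2 * s * (u - 1) * log s * ((u - 1) / (2 * (s - 1))) := by rw [entropyConst]; field_simp
    _ ≤ (s - 1) * (u + s) * log u * ((u - 1) / (2 * (s - 1))) :=
        mul_le_mul_of_nonneg_right (two_mul_mul_sub_one_mul_log_le_of_le hu hus)
          (div_nonneg hu1 (by positivity))
    _ = (u + s) / 2 * ((u - 1) * log u) := by field_simp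
    _ ≤ (u + s) / 2 * (2 * klFun u) :=
        mul_le_mul_of_nonneg_left (sub_one_mul_log_le_two_mul_klFun hu) (by linarith)
    _ = (u + s) * klFun u := by ring

theorem entropyConst_mul_sq_le_klFun {m u : ℝ} (hs : 1 < s) (hm : 0 ≤ m) (hu : 0 ≤ u)
    (hus : u ≤ s) (hm1 : m * (1 + s) ≤ 1) (hmu : m * (u + s) ≤ 1) :
    entropyConst s * m * (u - 1) ^ 2 ≤ klFun u := by
  rcases le_total u 1 with hu1 | hu1
  · have hconst : entropyConst s * m ≤ 1 / 2 := by
      calc entropyConst s * m ≤ (s + 1) / 2 * m := by gcongr; exact entropyConst_le hs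
        _ = m * (1 + s) / 2 := by ring
        _ ≤ 1 / 2 := by gcongr
    calc entropyConst s * m * (u - 1) ^ 2 ≤ 1 / 2 * (u - 1) ^ 2 := by gcongr
      _ = (u - 1) ^ 2 / 2 := by ring
      _ ≤ klFun u := half_sq_le_klFun hu hu1
  · calc entropyConst s * m * (u - 1) ^ 2 = m * (entropyConst s * (u - 1) ^ 2) := by ring
      _ ≤ m * ((u + s) * klFun u) :=
          mul_le_mul_of_nonneg_left (entropyConst_mul_sq_le hs hu1 hus) hm
      _ = m * (u + s) * klFun u := by ring
      _ ≤ 1 * klFun u := by gcongr; exact klFun_nonneg hu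
      _ = klFun u := one_mul _

theorem mul_klFun_div {y m : ℝ} (hm : m ≠ 0) :
    m * klFun (y / m) = y * log y - y * log m - (y - m) := by
  have hlog : y / m * log (y / m) = y / m * (log y - log m) := by
    rcases eq_or_ne y 0 with rfl | hy
    · simp
    · rw [log_div hy hm]
  rw [klFun_apply, hlog]
  field_simp
  ring

theorem entropyConst_mul_sq_sub_le {m y : ℝ} (hs : 1 < s) (hy : 0 ≤ y) (hym : y ≤ s * m)
    (hm1 : m * (1 + s) ≤ 1) (hmy : y + s * m ≤ 1) :
    entropyConst s * (y - m) ^ 2 ≤ y * log y - y * log m - (y - m) := by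
  have hm : 0 ≤ m := nonneg_of_mul_nonneg_right (hy.trans hym) (by linarith)
  rcases hm.eq_or_lt with rfl | hm
  · have hy0 : y = 0 := by linarith
    simp [hy0]
  · have h := mul_le_mul_of_nonneg_left (entropyConst_mul_sq_le_klFun (u := y / m) hs hm.le
      (by positivity) ((div_le_iff₀ hm).2 hym) hm1
      (by rw [mul_add, mul_div_cancel₀ _ hm.ne']; linarith)) hm.le
    rwa [mul_klFun_div hm.ne',
      show m * (entropyConst s * m * (y / m - 1) ^ 2) = entropyConst s * (y - m) ^ 2 by
        field_simp] at h

end EntropyConst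

section BinaryEntropy

theorem logit_mul_le {x y : ℝ} (hx : 0 < x) (hxy : x ≤ y) (hy : y ≤ 1 / 2) :
    (1 - 2 * x) * (log (1 - y) - log y) ≤ (1 - 2 * y) * (log (1 - x) - log x) := by
  have hy0 : 0 < y := hx.trans_le hxy
  have h := sub_one_mul_add_one_mul_log_le (r := (1 - y) / y) (t := (1 - x) / x)
    ((one_le_div hy0).2 (by linarith))
    (by rw [div_le_div_iff₀ hy0 hx]; linarith)
  rw [log_div (by linarith) hy0.ne', log_div (by linarith) hx.ne'] at h
  rw [show (1 - x) / x - 1 = (1 - 2 * x) / x by field_simp; ring,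
    show (1 - y) / y - 1 = (1 - 2 * y) / y by field_simp; ring,
    show (1 - x) / x + 1 = 1 / x by field_simp; ring,
    show (1 - y) / y + 1 = 1 / y by field_simp; ring] at h
  refine le_of_mul_le_mul_left ?_ (show 0 < 1 / (x * y) by positivity)
  calc 1 / (x * y) * ((1 - 2 * x) * (log (1 - y) - log y))
      = (1 - 2 * x) / x * (1 / y) * (log (1 - y) - log y) := by ring
    _ ≤ (1 - 2 * y) / y * (1 / x) * (log (1 - x) - log x) := h
    _ = 1 / (x * y) * ((1 - 2 * y) * (log (1 - x) - log x)) := by ring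

theorem hasDerivAt_binEntropy_sub (γ : ℝ) {x : ℝ} (hx0 : x ≠ 0) (hx1 : x ≠ 1) :
    HasDerivAt (fun x => binEntropy x - γ * (x * (1 - x)))
      (log (1 - x) - log x - γ * (1 - 2 * x)) x := by
  refine ((hasDerivAt_binEntropy hx0 hx1).sub
    (((hasDerivAt_id x).mul ((hasDerivAt_id x).const_sub 1)).const_mul γ)).congr_deriv ?_
  simp only [id]
  ring

theorem binEntropy_sub_le_of_le_half {q x : ℝ} (hq0 : 0 < q) (hq : q < 1 / 2) (hx0 : 0 ≤ x)
    (hx : x ≤ 1 / 2) :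
    binEntropy x - (log (1 - q) - log q) / (1 - 2 * q) * (x * (1 - x)) ≤
      binEntropy q - (log (1 - q) - log q) / (1 - 2 * q) * (q * (1 - q)) := by
  -- `γ` makes the derivative vanish at `q`; its sign elsewhere is given by `logit_mul_le`.
  have hq1 : 0 < 1 - 2 * q := by linarith
  set γ := (log (1 - q) - log q) / (1 - 2 * q) with hγ
  set f : ℝ → ℝ := fun x => binEntropy x - γ * (x * (1 - x))
  have hf : Continuous f := by fun_prop
  set f' : ℝ → ℝ := fun x => log (1 - x) - log x - γ * (1 - 2 * x)
  have hf' : ∀ u, 0 < u → u < 1 / 2 → HasDerivAt f (f' u) u :=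
    fun u hu0 hu => hasDerivAt_binEntropy_sub γ hu0.ne' (by linarith)
  rcases le_total x q with hxq | hqx
  · refine monotoneOn_of_hasDerivWithinAt_nonneg (f' := f') (convex_Icc 0 q) hf.continuousOn
      (fun u hu => ?_) (fun u hu => ?_) ⟨hx0, hxq⟩ ⟨hq0.le, le_rfl⟩ hxq
    all_goals rw [interior_Icc] at hu
    · exact (hf' u hu.1 (hu.2.trans hq)).hasDerivWithinAt
    · rw [sub_nonneg, hγ, div_mul_eq_mul_div, div_le_iff₀ hq1]
      linarith [logit_mul_le hu.1 hu.2.le hq.le]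
  · refine antitoneOn_of_hasDerivWithinAt_nonpos (f' := f') (convex_Icc q (1 / 2)) hf.continuousOn
      (fun u hu => ?_) (fun u hu => ?_) ⟨le_rfl, hq.le⟩ ⟨hqx, hx⟩ hqx
    all_goals rw [interior_Icc] at hu
    · exact (hf' u (hq0.trans hu.1) hu.2).hasDerivWithinAt
    · rw [sub_nonpos, hγ, div_mul_eq_mul_div, le_div_iff₀ hq1]
      linarith [logit_mul_le hq0 hu.1.le hu.2.le]

theorem binEntropy_sub_le {q x : ℝ} (hq0 : 0 < q) (hq : q < 1 / 2) (hx0 : 0 ≤ x) (hx1 : x ≤ 1) :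
    binEntropy x - (log (1 - q) - log q) / (1 - 2 * q) * (x * (1 - x)) ≤
      binEntropy q - (log (1 - q) - log q) / (1 - 2 * q) * (q * (1 - q)) := by
  rcases le_total x (1 / 2) with hx | hx
  · exact binEntropy_sub_le_of_le_half hq0 hq hx0 hx
  · have h := binEntropy_sub_le_of_le_half hq0 hq (x := 1 - x) (by linarith) (by linarith)
    rwa [binEntropy_one_sub, sub_sub_cancel, mul_comm (1 - x)] at h

theorem binEntropy_add_mul_log_le {s x : ℝ} (hs : 1 < s) (hx0 : 0 ≤ x) (hx1 : x ≤ 1) :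
    binEntropy x + x * log s ≤
      log (s + 1) - entropyConst s * ((1 - x) ^ 2 + x ^ 2 / s - 1 / (s + 1)) := by
  have hs0 : 0 < s := by linarith
  have hs1 : 0 < s - 1 := by linarith
  have hq : 1 - 1 / (s + 1) = s / (s + 1) := by field_simp; ring
  have hlogit : (log (1 - 1 / (s + 1)) - log (1 / (s + 1))) / (1 - 2 * (1 / (s + 1))) =
      log s * (s + 1) / (s - 1) := by
    rw [hq, ← log_div (by positivity) (by positivity),
      show 1 - 2 * (1 / (s + 1)) = (s - 1) / (s + 1) by field_simp; ring]
    field_simp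
  have hbin : binEntropy (1 / (s + 1)) = log (s + 1) - s / (s + 1) * log s := by
    rw [binEntropy, hq, one_div, inv_inv, inv_div, log_div (by positivity) hs0.ne']
    field_simp
    ring
  have h := binEntropy_sub_le (q := 1 / (s + 1)) (by positivity)
    (one_div_lt_one_div_of_lt two_pos (by linarith)) hx0 hx1
  rw [hlogit, hbin, hq] at h
  refine le_of_sub_nonneg ((sub_nonneg.2 h).trans_eq ?_)
  rw [entropyConst]
  field_simp
  ring

end BinaryEntropy

section Entropy

variable {ι : Type*}

theorem mul_log_add_le_sum_mul_log {s m : ℝ} {p : ι → ℝ} {t : Finset ι} (hs : 1 < s)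
    (ht : (t.card : ℝ) = s) (hp : ∀ i ∈ t, 0 ≤ p i) (hsum : ∑ i ∈ t, p i = s * m)
    (hm : m * (1 + s) ≤ 1) (hpm : ∀ i ∈ t, p i + s * m ≤ 1) :
    s * m * log m + entropyConst s * (∑ i ∈ t, p i ^ 2 - s * m ^ 2) ≤ ∑ i ∈ t, p i * log (p i) := by
  have h := Finset.sum_le_sum fun i hi => entropyConst_mul_sq_sub_le hs (hp i hi)
    (hsum ▸ Finset.single_le_sum hp hi) hm (hpm i hi)
  have hsq : ∑ i ∈ t, (p i - m) ^ 2 = ∑ i ∈ t, p i ^ 2 - s * m ^ 2 := by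
    simp only [sub_sq, Finset.sum_add_distrib, Finset.sum_sub_distrib, ← Finset.mul_sum,
      ← Finset.sum_mul, hsum, Finset.sum_const, nsmul_eq_mul, ht]
    ring
  rw [← Finset.mul_sum, hsq] at h
  simp only [Finset.sum_sub_distrib, ← Finset.sum_mul, hsum, Finset.sum_const, nsmul_eq_mul,
    ht] at h
  linarith

variable [Fintype ι]

theorem sum_negMulLog_le {p : ι → ℝ} (hp : p ∈ stdSimplex ℝ ι) (hι : 2 < Fintype.card ι) :
    ∑ i, negMulLog (p i) ≤ log (Fintype.card ι) -
      entropyConst (Fintype.card ι - 1) * (∑ i, p i ^ 2 - 1 / Fintype.card ι) := by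
  classical
  obtain ⟨i₀, hi₀⟩ : ∃ i₀, ∀ i, p i ≤ p i₀ :=
    have : Nonempty ι := Fintype.card_pos_iff.1 (by omega)
    Finite.exists_max p
  set t := Finset.univ.erase i₀
  have hsplit (f : ι → ℝ) : ∑ i, f i = f i₀ + ∑ i ∈ t, f i :=
    (Finset.add_sum_erase _ f (Finset.mem_univ i₀)).symm
  have hsum : ∑ i ∈ t, p i = 1 - p i₀ := by linarith [hsplit p, hp.2]
  have hmax : 1 ≤ Fintype.card ι * p i₀ := by
    simpa [hp.2] using Finset.sum_le_card_nsmul Finset.univ p (p i₀) fun i _ => hi₀ i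
  obtain ⟨s, hs⟩ : ∃ s : ℝ, (Fintype.card ι : ℝ) = s + 1 := ⟨_, (sub_add_cancel _ 1).symm⟩
  have hs1 : 1 < s := by linarith [(Nat.ofNat_lt_cast (α := ℝ)).2 hι]
  have ht : (t.card : ℝ) = s := by
    rw [Finset.card_erase_of_mem (Finset.mem_univ i₀), Finset.card_univ, Nat.cast_pred (by omega),
      hs, add_sub_cancel_right]
  rw [hs] at hmax ⊢
  set x := 1 - p i₀
  have hx0 : 0 ≤ x := hsum ▸ Finset.sum_nonneg fun i _ => hp.1 i
  have hxs : s * (x / s) = x := mul_div_cancel₀ _ (by linarith)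
  -- All entries but the largest are at most their sum `x` and `1 - x`, which is what the quadratic
  -- lower bound on `y * log y` needs; the split into `p i₀` and `x` is a binary entropy.
  have hrest := mul_log_add_le_sum_mul_log hs1 ht (fun i _ => hp.1 i) (hsum.trans hxs.symm)
    (by rw [div_mul_eq_mul_div, div_le_one (by linarith)]; linarith)
    (fun i _ => by linarith [hi₀ i])
  have hlog : x * log (x / s) = x * log x - x * log s := by
    rcases eq_or_ne x 0 with h | h
    · simp [h]
    · rw [log_div h (by linarith), mul_sub]
  have hbin := binEntropy_add_mul_log_le hs1 hx0 (by linarith [hp.1 i₀])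
  rw [binEntropy_eq_negMulLog_add_negMulLog_one_sub, show 1 - x = p i₀ from sub_sub_cancel _ _]
    at hbin
  rw [hxs, hlog, show s * (x / s) ^ 2 = x ^ 2 / s by field_simp] at hrest
  simp only [negMulLog, neg_mul, Finset.sum_neg_distrib, hsplit, add_sub_cancel_right] at hbin ⊢
  linarith

theorem sum_sum_negMulLog_le {κ : Type*} [Fintype κ] {q : κ → ι → ℝ}
    (hq : ∀ i, (Fintype.card κ : ℝ) • q i ∈ stdSimplex ℝ ι) (hκ : 0 < Fintype.card κ)
    (hι : 2 < Fintype.card ι) :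
    ∑ i, ∑ j, negMulLog (q i j) ≤ log (Fintype.card κ) + log (Fintype.card ι) -
      entropyConst (Fintype.card ι - 1) *
        (Fintype.card κ * ∑ i, ∑ j, q i j ^ 2 - 1 / Fintype.card ι) := by
  set K : ℝ := (Fintype.card κ : ℝ) with hK
  have hK0 : 0 < K := Nat.cast_pos.2 hκ
  have hrow (i : κ) : K * ∑ j, negMulLog (q i j) ≤ log K + log (Fintype.card ι) -
      entropyConst (Fintype.card ι - 1) * (K ^ 2 * ∑ j, q i j ^ 2 - 1 / Fintype.card ι) := by
    have hsum : K * ∑ j, q i j = 1 := by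
      simpa only [Pi.smul_apply, smul_eq_mul, ← Finset.mul_sum] using (hq i).2
    have hlog : (∑ j, q i j) * negMulLog K = -log K := by
      rw [negMulLog, neg_mul, mul_neg, ← mul_assoc, mul_comm _ K, hsum, one_mul]
    have h := sum_negMulLog_le (hq i) hι
    simp only [Pi.smul_apply, smul_eq_mul, negMulLog_mul, mul_pow, Finset.sum_add_distrib,
      ← Finset.mul_sum, ← Finset.sum_mul, hlog] at h
    linarith
  have h := Finset.sum_le_sum fun i (_ : i ∈ Finset.univ) => hrow i
  simp only [Finset.sum_sub_distrib, ← Finset.mul_sum, Finset.sum_const, Finset.card_univ,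
    nsmul_eq_mul, ← hK] at h
  refine le_of_mul_le_mul_left (h.trans_eq ?_) hK0
  ring

theorem sum_sq_sub_inv_card {p : ι → ℝ} (hp : ∑ i, p i = 1) :
    ∑ i, (p i - (Fintype.card ι : ℝ)⁻¹) ^ 2 = ∑ i, p i ^ 2 - (Fintype.card ι : ℝ)⁻¹ := by
  have hcard : (Fintype.card ι : ℝ) ≠ 0 := by
    have : Nonempty ι := not_isEmpty_iff.1 fun _ => by simp at hp
    exact Nat.cast_ne_zero.2 Fintype.card_ne_zero
  simp only [sub_sq, Finset.sum_add_distrib, Finset.sum_sub_distrib, ← Finset.mul_sum,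
    ← Finset.sum_mul, hp, Finset.sum_const, Finset.card_univ, nsmul_eq_mul]
  field_simp
  ring

end Entropy

section Stirling

theorem factorial_le_exp_mul_sqrt_mul_pow {n : ℕ} (hn : n ≠ 0) :
    (n.factorial : ℝ) ≤ exp 1 * √n * (n / exp 1) ^ n := by
  obtain ⟨m, rfl⟩ := Nat.exists_eq_succ_of_ne_zero hn
  have h : Stirling.stirlingSeq (m + 1) ≤ Stirling.stirlingSeq 1 :=
    Stirling.stirlingSeq'_antitone (Nat.zero_le m)
  rw [Stirling.stirlingSeq_one, Stirling.stirlingSeq, div_le_iff₀ (by positivity),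
    sqrt_mul (by norm_num)] at h
  refine h.trans_eq ?_
  field_simp

theorem sqrt_mul_pow_le_factorial (l : ℕ) : √(l + 1) * (l / exp 1) ^ l ≤ (l.factorial : ℝ) := by
  rcases Nat.eq_zero_or_pos l with rfl | hl
  · simp
  · refine le_trans ?_ (Stirling.le_factorial_stirling l)
    have hl' : (1 : ℝ) ≤ l := Nat.one_le_cast.2 hl
    gcongr
    nlinarith [pi_gt_three]

theorem div_exp_one_pow {n : ℕ} (hn : n ≠ 0) (l : ℕ) :
    ((l : ℝ) / exp 1) ^ l = (n / exp 1) ^ l * exp (-(n * negMulLog (l / n))) := by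
  have hn' : (n : ℝ) ≠ 0 := Nat.cast_ne_zero.2 hn
  rcases eq_or_ne l 0 with rfl | hl
  · simp
  · rw [show -((n : ℝ) * negMulLog (l / n)) = l * log (l / n) by rw [negMulLog]; field_simp,
      exp_nat_mul, exp_log (by positivity), ← mul_pow]
    field_simp

theorem factorial_div_prod_factorial_le {ι : Type*} [Fintype ι] {n : ℕ} (hn : n ≠ 0) {l : ι → ℕ}
    (hl : ∑ i, l i = n) :
    (n.factorial : ℝ) / ∏ i, ((l i).factorial : ℝ) ≤
      exp 1 * √n * ((∏ i, (√(l i + 1))⁻¹) * exp (n * ∑ i, negMulLog (l i / n))) := by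
  have hprod : (∏ i, √((l i : ℝ) + 1)) *
      ((n / exp 1) ^ n * exp (-(n * ∑ i, negMulLog (l i / n)))) ≤
        ∏ i, ((l i).factorial : ℝ) := by
    have h := Finset.prod_le_prod (s := Finset.univ) (fun i _ => by positivity)
      fun i _ => sqrt_mul_pow_le_factorial (l i)
    simp only [div_exp_one_pow hn, Finset.prod_mul_distrib, Finset.prod_pow_eq_pow_sum, ← exp_sum,
      Finset.sum_neg_distrib, ← Finset.mul_sum] at h
    rwa [hl] at h
  rw [div_le_iff₀ (Finset.prod_pos fun i _ => by positivity)]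
  calc (n.factorial : ℝ) ≤ exp 1 * √n * (n / exp 1) ^ n := factorial_le_exp_mul_sqrt_mul_pow hn
    _ = exp 1 * √n * ((∏ i, (√(l i + 1))⁻¹) * exp (n * ∑ i, negMulLog (l i / n))) *
        ((∏ i, √((l i : ℝ) + 1)) *
          ((n / exp 1) ^ n * exp (-(n * ∑ i, negMulLog (l i / n))))) := by
      have hsqrt : ∏ i, √((l i : ℝ) + 1) ≠ 0 := Finset.prod_ne_zero_iff.2 fun i _ => by positivity
      rw [exp_neg, Finset.prod_inv_distrib]
      field_simp
    _ ≤ _ := mul_le_mul_of_nonneg_left hprod (by positivity)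

end Stirling

theorem rpow_mul_sq_add_rpow_le_exp {a b x y : ℝ} (hx : 0 < x) (hy : 0 ≤ y) (hb : 0 ≤ b)
    (hab : a ≤ b) : x ^ (-2 * a) * (x ^ 2 + y) ^ a ≤ exp (b * (y / x ^ 2)) := by
  have hone : 1 ≤ 1 + y / x ^ 2 := le_add_of_nonneg_right (by positivity)
  calc x ^ (-2 * a) * (x ^ 2 + y) ^ a = (1 + y / x ^ 2) ^ a := by
        rw [neg_mul, rpow_neg hx.le, mul_comm 2 a, mul_comm a 2, rpow_mul hx.le, rpow_two,
          inv_mul_eq_div, ← div_rpow (by positivity) (by positivity)]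
        congr 1
        field_simp
    _ ≤ (1 + y / x ^ 2) ^ b := rpow_le_rpow_of_exponent_le hone hab
    _ ≤ exp (y / x ^ 2) ^ b := by
        gcongr
        rw [add_comm]
        exact add_one_le_exp _
    _ = exp (b * (y / x ^ 2)) := by rw [← exp_mul, mul_comm]

section GaussianSums

theorem sum_range_exp_neg_mul_sq_le {b : ℝ} (hb : 0 < b) (N : ℕ) :
    ∑ d ∈ Finset.range N, exp (-b * (d : ℝ) ^ 2) ≤ 1 + √(π / b) / 2 := by
  have hanti : AntitoneOn (fun x : ℝ => exp (-b * x ^ 2)) (Set.Icc 0 (0 + N)) := by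
    intro x hx y _ hxy
    simp only [exp_le_exp, neg_mul, neg_le_neg_iff]
    have hx0 := hx.1
    gcongr
  have hint : ∫ x in (0 : ℝ)..0 + N, exp (-b * x ^ 2) ≤ √(π / b) / 2 := by
    rw [← integral_gaussian_Ioi, intervalIntegral.integral_of_le (by positivity)]
    exact MeasureTheory.setIntegral_mono_set (integrable_exp_neg_mul_sq hb).integrableOn
      (Eventually.of_forall fun x => (exp_pos _).le) Set.Ioc_subset_Ioi_self.eventuallyLE
  calc ∑ d ∈ Finset.range N, exp (-b * (d : ℝ) ^ 2)
      ≤ ∑ d ∈ Finset.range (N + 1), exp (-b * (d : ℝ) ^ 2) :=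
        Finset.sum_le_sum_of_subset_of_nonneg (Finset.range_mono N.le_succ)
          fun _ _ _ => (exp_pos _).le
    _ = ∑ d ∈ Finset.range N, exp (-b * (0 + (d + 1 : ℕ)) ^ 2) + 1 := by
        simp [Finset.sum_range_succ']
    _ ≤ √(π / b) / 2 + 1 := by gcongr; exact hanti.sum_le_integral.trans hint
    _ = 1 + √(π / b) / 2 := add_comm _ _

theorem sum_range_exp_neg_mul_sub_sq_le {b μ : ℝ} (hb : 0 < b) (hμ : 0 ≤ μ) (N : ℕ) :
    ∑ m ∈ Finset.range N, exp (-b * ((m : ℝ) - μ) ^ 2) ≤ 2 + √(π / b) := by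
  set M := ⌊μ⌋₊
  have hM : (M : ℝ) ≤ μ := Nat.floor_le hμ
  have hM' : μ < M + 1 := Nat.lt_floor_add_one μ
  have hlow : ∑ m ∈ Finset.range (M + 1), exp (-b * ((m : ℝ) - μ) ^ 2) ≤ 1 + √(π / b) / 2 := by
    rw [← Finset.sum_range_reflect]
    refine (Finset.sum_le_sum fun d hd => ?_).trans (sum_range_exp_neg_mul_sq_le hb (M + 1))
    rw [Nat.add_sub_cancel, Nat.cast_sub (Finset.mem_range_succ_iff.1 hd), exp_le_exp, neg_mul,
      neg_mul, neg_le_neg_iff, ← neg_sq ((M : ℝ) - d - μ)]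
    gcongr
    linarith
  have hhigh : ∑ d ∈ Finset.range N, exp (-b * (((M + 1 + d : ℕ) : ℝ) - μ) ^ 2) ≤
      1 + √(π / b) / 2 := by
    refine (Finset.sum_le_sum fun d _ => ?_).trans (sum_range_exp_neg_mul_sq_le hb N)
    rw [exp_le_exp, neg_mul, neg_mul, neg_le_neg_iff]
    gcongr
    push_cast
    linarith
  calc ∑ m ∈ Finset.range N, exp (-b * ((m : ℝ) - μ) ^ 2)
      ≤ ∑ m ∈ Finset.range (M + 1 + N), exp (-b * ((m : ℝ) - μ) ^ 2) :=
        Finset.sum_le_sum_of_subset_of_nonneg (Finset.range_mono (Nat.le_add_left _ _))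
          fun _ _ _ => (exp_pos _).le
    _ ≤ (1 + √(π / b) / 2) + (1 + √(π / b) / 2) := by
        rw [Finset.sum_range_add]
        exact add_le_add hlow hhigh
    _ = 2 + √(π / b) := by ring

end GaussianSums

/-- The factor contributed by an entry equal to `m` to the bound on the term of a table: `w` is the
mean of the normalized entries `m / n`, and `κ` is the rate of the Gaussian decay around it. -/
noncomputable def entryWeight (κ w : ℝ) (n m : ℕ) : ℝ :=
  (√(m + 1))⁻¹ * exp (-(κ * n * (m / n - w) ^ 2))

section EntryWeight

variable {κ w : ℝ}

theorem entryWeight_nonneg (n m : ℕ) : 0 ≤ entryWeight κ w n m := by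
  unfold entryWeight
  positivity

theorem exp_neg_le_inv_sqrt {z : ℝ} (hz : 0 < z) : exp (-z) ≤ (√z)⁻¹ := by
  rw [exp_neg]
  gcongr
  calc √z ≤ z + 1 := by rw [sqrt_le_left (by linarith)]; nlinarith
    _ ≤ exp z := add_one_le_exp z

theorem exists_entryWeight_le (hκ : 0 < κ) (hw : 0 < w) :
    ∃ C, ∀ n ≠ 0, ∀ m, entryWeight κ w n m ≤ C / √n := by
  refine ⟨max (√(w / 2))⁻¹ (√(κ * (w / 2) ^ 2))⁻¹, fun n hn m => ?_⟩
  have hn' : (0 : ℝ) < n := Nat.cast_pos.2 (Nat.pos_of_ne_zero hn)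
  have hsqrt : (√((m : ℝ) + 1))⁻¹ ≤ 1 := inv_le_one_of_one_le₀ (one_le_sqrt.2 (by simp))
  have hexp : exp (-(κ * n * ((m : ℝ) / n - w) ^ 2)) ≤ 1 :=
    exp_le_one_iff.2 (neg_nonpos.2 (by positivity))
  rcases le_total (w / 2) (m / n) with hm | hm
  · calc entryWeight κ w n m ≤ (√((m : ℝ) + 1))⁻¹ := mul_le_of_le_one_right (by positivity) hexp
      _ ≤ (√(w / 2 * n))⁻¹ := by
        gcongr
        linarith [(le_div_iff₀ hn').1 hm]
      _ = (√(w / 2))⁻¹ / √n := by rw [sqrt_mul (by positivity), mul_inv, div_eq_mul_inv _ √(n : ℝ)]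
      _ ≤ _ := by gcongr; exact le_max_left _ _
  · calc entryWeight κ w n m ≤ exp (-(κ * n * ((m : ℝ) / n - w) ^ 2)) :=
          mul_le_of_le_one_left (exp_pos _).le hsqrt
      _ ≤ exp (-(κ * (w / 2) ^ 2 * n)) := by
        rw [exp_le_exp, neg_le_neg_iff, mul_right_comm, ← sq_abs ((m : ℝ) / n - w), abs_sub_comm]
        gcongr
        exact le_abs.2 (Or.inl (by linarith))
      _ ≤ (√(κ * (w / 2) ^ 2 * n))⁻¹ := exp_neg_le_inv_sqrt (by positivity)
      _ = (√(κ * (w / 2) ^ 2))⁻¹ / √n := by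
        rw [sqrt_mul (by positivity), mul_inv, div_eq_mul_inv _ √(n : ℝ)]
      _ ≤ _ := by gcongr; exact le_max_right _ _

theorem entryWeight_eq_mul {n : ℕ} (hn : n ≠ 0) (m : ℕ) :
    entryWeight κ w n m =
      entryWeight (κ / 2) w n m * exp (-(κ / (2 * n)) * ((m : ℝ) - n * w) ^ 2) := by
  have hn' : (n : ℝ) ≠ 0 := Nat.cast_ne_zero.2 hn
  rw [entryWeight, entryWeight, mul_assoc (√((m : ℝ) + 1))⁻¹, ← exp_add]
  congr 2
  field_simp
  ring

theorem exists_sum_entryWeight_le (hκ : 0 < κ) (hw : 0 < w) :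
    ∃ C, ∀ n ≠ 0, ∀ N, ∑ m ∈ Finset.range N, entryWeight κ w n m ≤ C := by
  -- Half of the Gaussian decay bounds each weight by `C / √n`, the other half is summed over `m`.
  obtain ⟨C, hC⟩ := exists_entryWeight_le (half_pos hκ) hw
  refine ⟨C * (2 + √(2 * π / κ)), fun n hn N => ?_⟩
  have hn' : (1 : ℝ) ≤ n := Nat.one_le_cast.2 (Nat.pos_of_ne_zero hn)
  have hsqrt : 1 ≤ √(n : ℝ) := one_le_sqrt.2 hn'
  have hC0 : 0 ≤ C / √n := (entryWeight_nonneg n 0).trans (hC n hn 0)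
  calc ∑ m ∈ Finset.range N, entryWeight κ w n m
      ≤ ∑ m ∈ Finset.range N, C / √n * exp (-(κ / (2 * n)) * ((m : ℝ) - n * w) ^ 2) := by
        refine Finset.sum_le_sum fun m _ => ?_
        rw [entryWeight_eq_mul hn]
        gcongr
        exact hC n hn m
    _ ≤ C / √n * (2 + √(π / (κ / (2 * n)))) := by
        rw [← Finset.mul_sum]
        gcongr
        exact sum_range_exp_neg_mul_sub_sq_le (by positivity) (by positivity) N
    _ = C / √n * (2 + √(2 * π / κ) * √n) := by
        rw [← sqrt_mul (by positivity)]
        congr 3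
        field_simp
    _ ≤ C / √n * ((2 + √(2 * π / κ)) * √n) := by
        gcongr
        linarith
    _ = C * (2 + √(2 * π / κ)) := by field_simp

end EntryWeight

section Tables

theorem eq_of_sum_eq_of_eqOn_compl {ι M : Type*} [Fintype ι] [AddCancelCommMonoid M] {f g : ι → M}
    {i₀ : ι} (hsum : ∑ i, f i = ∑ i, g i) (h : ∀ i ≠ i₀, f i = g i) : f = g := by
  classical
  funext i
  rcases eq_or_ne i i₀ with rfl | hi
  · rw [← Finset.add_sum_erase _ f (Finset.mem_univ i),
      ← Finset.add_sum_erase _ g (Finset.mem_univ i),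
      Finset.sum_congr rfl fun j hj => h j (Finset.ne_of_mem_erase hj)] at hsum
    exact add_right_cancel hsum
  · exact h i hi

theorem eq_of_mem_tables_of_eqOn {k n : ℕ} {ℓ ℓ' : Fin k → Fin k → ℕ} (hℓ : ℓ ∈ tables k n)
    (hℓ' : ℓ' ∈ tables k n) {i₀ : Fin k} (h : ∀ i ≠ i₀, ∀ j ≠ i₀, ℓ i j = ℓ' i j) : ℓ = ℓ' := by
  have cancel {a b : ℕ} (ha : k * a = n) (hb : k * b = n) : a = b :=
    Nat.eq_of_mul_eq_mul_left i₀.pos (ha.trans hb.symm)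
  rw [mem_tables] at hℓ hℓ'
  have hrow (i : Fin k) (hi : i ≠ i₀) : ℓ i = ℓ' i :=
    eq_of_sum_eq_of_eqOn_compl (cancel (hℓ.1 i) (hℓ'.1 i)) (h i hi)
  refine eq_of_sum_eq_of_eqOn_compl (funext fun j => ?_) hrow
  rw [Finset.sum_apply, Finset.sum_apply]
  exact cancel (hℓ.2 j) (hℓ'.2 j)

theorem sum_prod_le_pow_mul_sum_pow {X ι α : Type*} [Fintype ι] [DecidableEq ι] [Nonempty α]
    {S : Finset X}
    {x : X → ι → α} {B : Finset ι} {t : Finset α} {g : α → ℝ} {M : ℝ}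
    (hinj : Set.InjOn (fun f => B.restrict (x f)) S) (ht : ∀ f ∈ S, ∀ i ∈ B, x f i ∈ t)
    (hg : ∀ a, 0 ≤ g a) (hM : ∀ a, g a ≤ M) :
    ∑ f ∈ S, ∏ i, g (x f i) ≤ M ^ (Bᶜ).card * (∑ a ∈ t, g a) ^ B.card := by
  classical
  have hM0 : 0 ≤ M := (hg (Classical.arbitrary α)).trans (hM _)
  calc ∑ f ∈ S, ∏ i, g (x f i)
      ≤ ∑ f ∈ S, M ^ (Bᶜ).card * ∏ i : B, g (x f i) := by
        refine Finset.sum_le_sum fun f _ => ?_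
        rw [← Finset.prod_mul_prod_compl B, mul_comm, Finset.prod_coe_sort B fun i => g (x f i)]
        gcongr
        · exact Finset.prod_nonneg fun _ _ => hg _
        · exact (Finset.prod_le_prod (fun _ _ => hg _) fun _ _ => hM _).trans_eq
            (Finset.prod_const M)
    _ = M ^ (Bᶜ).card * ∑ r ∈ S.image fun f => B.restrict (x f), ∏ i, g (r i) := by
        rw [← Finset.mul_sum, Finset.sum_image hinj]
        rfl
    _ ≤ M ^ (Bᶜ).card * ∑ r ∈ Fintype.piFinset fun _ : B => t, ∏ i, g (r i) := by
        gcongr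
        · exact fun _ _ _ => Finset.prod_nonneg fun _ _ => hg _
        · simp only [Finset.image_subset_iff, Fintype.mem_piFinset]
          exact fun f hf i => ht f hf i i.2
    _ = M ^ (Bᶜ).card * (∑ a ∈ t, g a) ^ B.card := by
        rw [Finset.sum_prod_piFinset t fun _ => g, Finset.prod_const, Finset.card_univ,
          Fintype.card_coe]

theorem sum_tables_prod_le {k n : ℕ} (hk : k ≠ 0) {g : ℕ → ℝ} {M : ℝ} (hg : ∀ m, 0 ≤ g m)
    (hM : ∀ m, g m ≤ M) :
    ∑ ℓ ∈ tables k n, ∏ i, ∏ j, g (ℓ i j) ≤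
      M ^ (2 * k - 1) * (∑ m ∈ Finset.range (n + 1), g m) ^ (k - 1) ^ 2 := by
  obtain ⟨K, rfl⟩ := Nat.exists_eq_add_one_of_ne_zero hk
  let B : Finset (Fin (K + 1) × Fin (K + 1)) := {0}ᶜ ×ˢ {0}ᶜ
  have hB : B.card = K ^ 2 := by simp [B, Finset.card_compl, sq]
  have hBc : (Bᶜ).card = 2 * (K + 1) - 1 := by
    rw [Finset.card_compl, hB, Fintype.card_prod, Fintype.card_fin,
      show (K + 1) * (K + 1) = 2 * K + 1 + K ^ 2 by ring, Nat.add_sub_cancel]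
    lia
  have h := sum_prod_le_pow_mul_sum_pow (S := tables (K + 1) n) (x := fun ℓ p => ℓ p.1 p.2) (B := B)
    (t := Finset.range (n + 1)) (fun ℓ hℓ ℓ' hℓ' h => ?_) (fun ℓ hℓ p _ => ?_) hg hM
  · simpa only [Fintype.prod_prod_type, hB, hBc, Nat.add_sub_cancel] using h
  · refine eq_of_mem_tables_of_eqOn hℓ hℓ' (i₀ := 0) fun i hi j hj => ?_
    exact congrFun h ⟨(i, j), by simp [B, hi, hj]⟩
  · exact Fintype.mem_piFinset.1 (Fintype.mem_piFinset.1 (Finset.mem_filter.1 hℓ).1 p.1) p.2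

end Tables

/-- The squared Euclidean distance between the normalized table `ℓ / n` and the uniform table, all
of whose entries are `1 / k ^ 2`. -/
noncomputable def sqDeviation {k : ℕ} (n : ℕ) (ℓ : Fin k → Fin k → ℕ) : ℝ :=
  ∑ i, ∑ j, ((ℓ i j : ℝ) / n - 1 / (k : ℝ) ^ 2) ^ 2

/-- The rate `κ` at which the terms of `A k b n` decay, as `exp (-(κ * n * sqDeviation n ℓ))`, away
from the uniform table: the entropy deficit minus the gain from the collision probability. -/
noncomputable def decayRate (k : ℕ) (b : ℝ) : ℝ :=
  k * entropyConst (k - 1) - b / (1 - 1 / (k : ℝ)) ^ 2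

theorem decayRate_pos {k : ℕ} {b : ℝ} (hk : 3 ≤ k)
    (hb : b < ((k : ℝ) - 1) ^ 3 * log (k - 1) / (k * (k - 2))) : 0 < decayRate k b := by
  have hk' : (3 : ℝ) ≤ k := Nat.ofNat_le_cast.2 hk
  have hk1 : (0 : ℝ) < k - 1 := by linarith
  have hk2 : (0 : ℝ) < k - 2 := by linarith
  rw [lt_div_iff₀ (by positivity)] at hb
  rw [decayRate, entropyConst, sub_pos, show (k : ℝ) - 1 - 1 = k - 2 by ring,
    show 1 - 1 / (k : ℝ) = (k - 1) / k by field_simp, ← mul_div_assoc, div_pow, div_div_eq_mul_div,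
    div_lt_div_iff₀ (by positivity) hk2]
  nlinarith [mul_lt_mul_of_pos_right hb (show (0 : ℝ) < k by positivity)]

section TableBounds

variable {k n : ℕ} {ℓ : Fin k → Fin k → ℕ}

theorem sqDeviation_nonneg : 0 ≤ sqDeviation n ℓ :=
  Finset.sum_nonneg fun _ _ => Finset.sum_nonneg fun _ _ => sq_nonneg _

theorem prod_prod_entryWeight (κ : ℝ) :
    ∏ i, ∏ j, entryWeight κ (1 / (k : ℝ) ^ 2) n (ℓ i j) =
      (∏ i, ∏ j, (√((ℓ i j : ℝ) + 1))⁻¹) * exp (-(κ * n * sqDeviation n ℓ)) := by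
  simp only [entryWeight, sqDeviation, Finset.prod_mul_distrib, ← exp_sum, Finset.sum_neg_distrib,
    Finset.mul_sum]

theorem smul_div_mem_stdSimplex (hn : n ≠ 0) (hℓ : ℓ ∈ tables k n) (i : Fin k) :
    (k : ℝ) • (fun j => (ℓ i j : ℝ) / n) ∈ stdSimplex ℝ (Fin k) := by
  refine ⟨fun j => by simp only [Pi.smul_apply, smul_eq_mul]; positivity, ?_⟩
  have hrow : (k : ℝ) * ∑ j, (ℓ i j : ℝ) = n := mod_cast (mem_tables.1 hℓ).1 i
  simp only [Pi.smul_apply, smul_eq_mul]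
  rw [← Finset.mul_sum, ← Finset.sum_div, ← mul_div_assoc, hrow, div_self (Nat.cast_ne_zero.2 hn)]

theorem sum_sum_eq_of_mem_tables (hk : k ≠ 0) (hℓ : ℓ ∈ tables k n) : ∑ i, ∑ j, ℓ i j = n := by
  refine Nat.eq_of_mul_eq_mul_left (Nat.pos_of_ne_zero hk) ?_
  rw [Finset.mul_sum, Finset.sum_congr rfl fun i _ => (mem_tables.1 hℓ).1 i]
  simp

theorem sum_sum_div_sq_eq (hk : k ≠ 0) (hn : n ≠ 0) (hℓ : ℓ ∈ tables k n) :
    ∑ i, ∑ j, ((ℓ i j : ℝ) / n) ^ 2 = sqDeviation n ℓ + 1 / (k : ℝ) ^ 2 := by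
  have hsum : ∑ p : Fin k × Fin k, (ℓ p.1 p.2 : ℝ) / n = 1 := by
    rw [← Finset.sum_div, Fintype.sum_prod_type,
      div_eq_one_iff_eq (Nat.cast_ne_zero.2 hn)]
    exact_mod_cast sum_sum_eq_of_mem_tables hk hℓ
  have h := sum_sq_sub_inv_card hsum
  simp only [Fintype.card_prod, Fintype.card_fin, ← sq, Nat.cast_pow, ← one_div,
    Fintype.sum_prod_type] at h
  rw [sqDeviation, h, sub_add_cancel]

theorem factorial_div_prod_prod_factorial_le (hk : 3 ≤ k) (hn : n ≠ 0) (hℓ : ℓ ∈ tables k n) :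
    (n.factorial : ℝ) / ∏ i, ∏ j, ((ℓ i j).factorial : ℝ) ≤
      exp 1 * √n * (k : ℝ) ^ (2 * n) * ((∏ i, ∏ j, (√((ℓ i j : ℝ) + 1))⁻¹) *
        exp (-(k * entropyConst (k - 1) * n * sqDeviation n ℓ))) := by
  have hentropy := sum_sum_negMulLog_le (q := fun i j => (ℓ i j : ℝ) / n)
    (by simpa only [Fintype.card_fin] using smul_div_mem_stdSimplex hn hℓ)
    (by rw [Fintype.card_fin]; omega) (by rw [Fintype.card_fin]; omega)
  rw [Fintype.card_fin, sum_sum_div_sq_eq (by omega) hn hℓ] at hentropy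
  have hmult := factorial_div_prod_factorial_le hn (l := fun p : Fin k × Fin k => ℓ p.1 p.2)
    (by rw [Fintype.sum_prod_type]; exact sum_sum_eq_of_mem_tables (by omega) hℓ)
  simp only [Fintype.prod_prod_type, Fintype.sum_prod_type] at hmult
  have hexp : exp (n * ∑ i, ∑ j, negMulLog ((ℓ i j : ℝ) / n)) ≤
      (k : ℝ) ^ (2 * n) * exp (-(k * entropyConst (k - 1) * n * sqDeviation n ℓ)) := by
    rw [← exp_log (show 0 < (k : ℝ) ^ (2 * n) by positivity), ← exp_add, exp_le_exp, log_pow]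
    refine (mul_le_mul_of_nonneg_left hentropy n.cast_nonneg).trans_eq ?_
    push_cast
    field_simp
    ring
  calc _ ≤ exp 1 * √n * ((∏ i, ∏ j, (√((ℓ i j : ℝ) + 1))⁻¹) *
        ((k : ℝ) ^ (2 * n) * exp (-(k * entropyConst (k - 1) * n * sqDeviation n ℓ)))) := by
        refine hmult.trans ?_
        gcongr
    _ = _ := by ring

theorem rpow_mul_collision_rpow_le {b c : ℝ} (hk : 2 ≤ k) (hn : n ≠ 0) (hℓ : ℓ ∈ tables k n)
    (hb : 0 ≤ b) (hcb : c ≤ b) :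
    (1 - 1 / (k : ℝ)) ^ (-2 * (n : ℝ) * c) *
        (1 - 2 / (k : ℝ) + ∑ i, ∑ j, ((ℓ i j : ℝ) / n) ^ 2) ^ ((n : ℝ) * c) ≤
      exp (b / (1 - 1 / (k : ℝ)) ^ 2 * n * sqDeviation n ℓ) := by
  have hk' : (2 : ℝ) ≤ k := Nat.ofNat_le_cast.2 hk
  have hbase : 0 < 1 - 1 / (k : ℝ) := by
    rw [sub_pos, div_lt_one (by linarith)]
    linarith
  have h := rpow_mul_sq_add_rpow_le_exp hbase (sqDeviation_nonneg (n := n) (ℓ := ℓ))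
    (mul_nonneg n.cast_nonneg hb) (mul_le_mul_of_nonneg_left hcb n.cast_nonneg)
  rw [sum_sum_div_sq_eq (by omega) hn hℓ, mul_assoc (-2 : ℝ),
    show 1 - 2 / (k : ℝ) + (sqDeviation n ℓ + 1 / (k : ℝ) ^ 2) =
      (1 - 1 / (k : ℝ)) ^ 2 + sqDeviation n ℓ by ring]
  refine h.trans_eq (congrArg exp ?_)
  ring

theorem factorial_div_mul_rpow_le {b c : ℝ} (hk : 3 ≤ k) (hn : n ≠ 0) (hℓ : ℓ ∈ tables k n)
    (hb : 0 ≤ b) (hcb : c ≤ b) :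
    (1 - 1 / (k : ℝ)) ^ (-2 * (n : ℝ) * c) *
        ((n.factorial : ℝ) / (∏ i, ∏ j, ((ℓ i j).factorial : ℝ)) *
          (1 - 2 / (k : ℝ) + ∑ i, ∑ j, ((ℓ i j : ℝ) / n) ^ 2) ^ ((n : ℝ) * c)) ≤
      exp 1 * √n * (k : ℝ) ^ (2 * n) *
        ∏ i, ∏ j, entryWeight (decayRate k b) (1 / (k : ℝ) ^ 2) n (ℓ i j) := by
  calc _ = (n.factorial : ℝ) / (∏ i, ∏ j, ((ℓ i j).factorial : ℝ)) *
        ((1 - 1 / (k : ℝ)) ^ (-2 * (n : ℝ) * c) *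
          (1 - 2 / (k : ℝ) + ∑ i, ∑ j, ((ℓ i j : ℝ) / n) ^ 2) ^ ((n : ℝ) * c)) := by ring
    _ ≤ (n.factorial : ℝ) / (∏ i, ∏ j, ((ℓ i j).factorial : ℝ)) *
        exp (b / (1 - 1 / (k : ℝ)) ^ 2 * n * sqDeviation n ℓ) :=
      mul_le_mul_of_nonneg_left (rpow_mul_collision_rpow_le (by omega) hn hℓ hb hcb)
        (by positivity)
    _ ≤ exp 1 * √n * (k : ℝ) ^ (2 * n) * ((∏ i, ∏ j, (√((ℓ i j : ℝ) + 1))⁻¹) *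
          exp (-(k * entropyConst (k - 1) * n * sqDeviation n ℓ))) *
        exp (b / (1 - 1 / (k : ℝ)) ^ 2 * n * sqDeviation n ℓ) :=
      mul_le_mul_of_nonneg_right (factorial_div_prod_prod_factorial_le hk hn hℓ) (exp_pos _).le
    _ = _ := by
      rw [prod_prod_entryWeight, decayRate, mul_assoc, mul_assoc _ (exp _) (exp _), ← exp_add]
      ring_nf

end TableBounds

theorem A_nonneg {k : ℕ} (hk : 2 ≤ k) (c : ℝ) (n : ℕ) : 0 ≤ A k c n := by
  have hk' : (2 : ℝ) ≤ k := Nat.ofNat_le_cast.2 hk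
  have h1 : 0 ≤ 1 - 1 / (k : ℝ) := by rw [sub_nonneg, div_le_one (by linarith)]; linarith
  have h2 : 0 ≤ 1 - 2 / (k : ℝ) := by rw [sub_nonneg, div_le_one (by linarith)]; exact hk'
  unfold A
  positivity

theorem A_le_sum_prod_entryWeight {k n : ℕ} {b c : ℝ} (hk : 3 ≤ k) (hn : n ≠ 0)
    (hb : 0 ≤ b) (hcb : c ≤ b) :
    A k c n ≤ (n : ℝ) ^ (k - 1) * (exp 1 * √n * ∑ ℓ ∈ tables k n,
      ∏ i, ∏ j, entryWeight (decayRate k b) (1 / (k : ℝ) ^ 2) n (ℓ i j)) := by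
  have h := Finset.sum_le_sum fun ℓ hℓ => factorial_div_mul_rpow_le hk hn hℓ hb hcb
  rw [← Finset.mul_sum, ← Finset.mul_sum] at h
  rw [A, mul_assoc]
  refine (mul_le_mul_of_nonneg_left h (by positivity)).trans_eq ?_
  field_simp

theorem exists_A_le {k : ℕ} {b c : ℝ} (hk : 3 ≤ k) (hb : 0 ≤ b) (hcb : c ≤ b)
    (hrate : 0 < decayRate k b) : ∃ C, ∀ n ≠ 0, A k c n ≤ C := by
  have hw : 0 < 1 / (k : ℝ) ^ 2 := by positivity
  obtain ⟨C₁, hC₁⟩ := exists_entryWeight_le hrate hw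
  obtain ⟨C₂, hC₂⟩ := exists_sum_entryWeight_le hrate hw
  refine ⟨exp 1 * C₁ ^ (2 * k - 1) * C₂ ^ (k - 1) ^ 2, fun n hn => ?_⟩
  have hn' : (0 : ℝ) < n := Nat.cast_pos.2 (Nat.pos_of_ne_zero hn)
  have hC₁' : 0 ≤ C₁ / √n := (entryWeight_nonneg n 0).trans (hC₁ n hn 0)
  have hpow : (n : ℝ) ^ (k - 1) * √n = √n ^ (2 * k - 1) := by
    rw [show 2 * k - 1 = 2 * (k - 1) + 1 by omega, pow_succ, pow_mul, sq_sqrt hn'.le]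
  calc A k c n ≤ (n : ℝ) ^ (k - 1) * (exp 1 * √n * ∑ ℓ ∈ tables k n,
        ∏ i, ∏ j, entryWeight (decayRate k b) (1 / (k : ℝ) ^ 2) n (ℓ i j)) :=
      A_le_sum_prod_entryWeight hk hn hb hcb
    _ ≤ (n : ℝ) ^ (k - 1) * (exp 1 * √n * ((C₁ / √n) ^ (2 * k - 1) * C₂ ^ (k - 1) ^ 2)) := by
      gcongr
      refine (sum_tables_prod_le (by omega) (entryWeight_nonneg n) (hC₁ n hn)).trans ?_
      gcongr
      · exact Finset.sum_nonneg fun _ _ => entryWeight_nonneg _ _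
      · exact hC₂ n hn (n + 1)
    _ = exp 1 * ((n : ℝ) ^ (k - 1) * √n * (C₁ / √n) ^ (2 * k - 1)) * C₂ ^ (k - 1) ^ 2 := by ring
    _ = exp 1 * C₁ ^ (2 * k - 1) * C₂ ^ (k - 1) ^ 2 := by
      rw [hpow, ← mul_pow, mul_div_cancel₀ _ (by positivity)]

theorem sub_one_mul_log_le {k : ℝ} (hk : 2 < k) :
    (k - 1) * log (k - 1) ≤ (k - 1) ^ 3 * log (k - 1) / (k * (k - 2)) := by
  have hlog : 0 ≤ (k - 1) * log (k - 1) :=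
    mul_nonneg (by linarith) (log_nonneg (by linarith))
  rw [le_div_iff₀ (mul_pos (by linarith) (by linarith))]
  calc (k - 1) * log (k - 1) * (k * (k - 2)) ≤ (k - 1) * log (k - 1) * (k - 1) ^ 2 := by
        gcongr
        linarith
    _ = (k - 1) ^ 3 * log (k - 1) := by ring

end AchlioptasNaor

theorem mainTheorem1_general (k : ℕ) (hk : 3 ≤ k) (c : ℝ)
    (hc : c < ((k : ℝ) - 1) ^ 3 * Real.log ((k : ℝ) - 1) / ((k : ℝ) * ((k : ℝ) - 2))) :
    (fun n : ℕ => AchlioptasNaor.A k c n) =O[atTop] (fun _ : ℕ => (1 : ℝ)) := by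
  have hk' : (3 : ℝ) ≤ k := Nat.ofNat_le_cast.2 hk
  have hthreshold : 0 < ((k : ℝ) - 1) ^ 3 * Real.log (k - 1) / (k * (k - 2)) :=
    div_pos (mul_pos (pow_pos (by linarith) 3) (Real.log_pos (by linarith)))
      (mul_pos (by linarith) (by linarith))
  obtain ⟨C, hC⟩ := AchlioptasNaor.exists_A_le hk (le_max_right c 0) (le_max_left c 0)
    (AchlioptasNaor.decayRate_pos hk (max_lt hc hthreshold))
  refine IsBigO.of_bound C ?_
  filter_upwards [eventually_ne_atTop 0] with n hn
  rw [Real.norm_of_nonneg (AchlioptasNaor.A_nonneg (by omega) c n), norm_one, mul_one]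
  exact hC n hn

theorem mainTheorem1 (k : ℕ) (hk : 3 ≤ k) (c : ℝ)
    (hc : c < ((k : ℝ) - 1) * Real.log ((k : ℝ) - 1)) :
    (fun n : ℕ => AchlioptasNaor.A k c n) =O[atTop ⊓ 𝓟 {n : ℕ | k ∣ n}] (fun _ : ℕ => (1 : ℝ)) :=
  (mainTheorem1_general k hk c <| hc.trans_le <|
    AchlioptasNaor.sub_one_mul_log_le (by exact_mod_cast hk)).mono inf_le_left
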